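/- All graphs are finite and simple. For a connected graph $G$ of order $n\ge 2$ and a vertex $v$, let $\sigma(v)$ be the sum of the distances from $v$ to all other vertices, $\overline{\sigma}(v)=\sigma(v)/(n-1)$, and let the remoteness of $G$ be $\rho(G)=\max_{v}\overline{\sigma}(v)$. A simple triangulation (resp. simple quadrangulation) is a connected simple plane graph with at least one edge in which every face is bounded by a $3$-cycle (resp. a $4$-cycle). (a) If $G$ is a simple triangulation of order $n$, then $$\rho(G)\le \frac{n+2}{6}+\varepsilon_n,$$ where $\varepsilon_n=0$ if $n\equiv 1\pmod 3$ and $\varepsilon_n=\frac{1}{3(n-1)}$ if $n\equiv 0,2\pmod 3$. For every $n\ge 3$ equality holds for some simple triangulation of order $n$. (b) If $G$ is a $4$-connected simple triangulation of order $n$, then $$\rho(G)\le \frac{n+3}{8}+\varepsilon_n,$$ where $\varepsilon_n=0$ if $n\equiv 1\pmod 4$, $\varepsilon_n=\frac{3}{8(n-1)}$ if $n\equiv 0,2\pmod 4$, and $\varepsilon_n=\frac{1}{2(n-1)}$ if $n\equiv 3\pmod 4$. For every $n\ge 6$ equality holds for some $4$-connected simple triangulation of order $n$. (c) If $G$ is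 a simple quadrangulation of order $n$, then $$\rho(G)\le \frac{n+1}{4}+\varepsilon_n,$$ where $\varepsilon_n=0$ if $n$ is odd and $\varepsilon_n=\frac{1}{4(n-1)}$ if $n$ is even. For every $n\ge 4$ equality holds for some simple quadrangulation of order $n$. -/

import Mathlib

namespace SimpleGraph

variable {V : Type*}

/-- The face permutation `(u, v) ↦ rot (v, u)` of a permutation `rot` of the darts (oriented edges)
of `G`. If `rot` turns every dart around its starting vertex, then its orbits are the facial walks:
after traversing `(u, v)` one continues with the dart at `v` next to `(v, u)`. -/
def facePerm {G : SimpleGraph V} (rot : Equiv.Perm G.Dart) : Equiv.Perm G.Dart :=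
  rot * Function.Involutive.toPerm Dart.symm Dart.symm_involutive

/-- An embedding of a finite connected simple graph with at least one edge in the plane (sphere),
given by its rotation system (combinatorial map): `rot` arranges the darts at each vertex in their
cyclic order around that vertex, the faces are the orbits of the face permutation, and the surface
is the sphere, that is, `|V| - |E| + |F| = 2`. (A one-vertex graph has no darts; it carries no such
structure.) -/
structure PlaneEmbedding (G : SimpleGraph V) where
  /-- The rotation system. -/
  rot : Equiv.Perm G.Dart
  /-- The darts with a given starting vertex form a single cycle of the rotation. -/
  isCycleOn_rot : ∀ v : V, rot.IsCycleOn {d : G.Dart | d.fst = v}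
  /-- The graph is connected. -/
  connected : G.Connected
  /-- Euler's formula `|V| + |F| = |E| + 2`. -/
  euler : Nat.card V + Nat.card (Quotient (Equiv.Perm.SameCycle.setoid (facePerm rot)))
    = Nat.card G.edgeSet + 2

/-- Every face is bounded by a cycle of length `k`: every facial walk closes up after `k` steps, and
the `k` vertices which it visits are distinct. -/
def PlaneEmbedding.AllFacesCycles {G : SimpleGraph V} (M : G.PlaneEmbedding) (k : ℕ) : Prop :=
  ∀ d : G.Dart, (facePerm M.rot ^ k) d = d ∧
    Set.InjOn (fun i : ℕ => ((facePerm M.rot ^ i) d).fst) (Set.Iio k)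

/-- A simple triangulation: a simple plane graph all of whose faces are triangles. -/
def IsSimpleTriangulation (G : SimpleGraph V) : Prop :=
  ∃ M : G.PlaneEmbedding, M.AllFacesCycles 3

/-- A simple quadrangulation: a simple plane graph all of whose faces are 4-cycles. -/
def IsSimpleQuadrangulation (G : SimpleGraph V) : Prop :=
  ∃ M : G.PlaneEmbedding, M.AllFacesCycles 4

/-- `k`-connectedness: more than `k` vertices, and deleting fewer than `k` vertices never
disconnects the graph. -/
def IsVertexConnected (G : SimpleGraph V) (k : ℕ) : Prop :=
  k < Nat.card V ∧ ∀ S : Finset V, S.card < k → (G.induce ((S : Set V)ᶜ)).Connected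

/-- The total distance `σ(v)` of a vertex: the sum of its distances to all other vertices. -/
noncomputable def totalDist [Fintype V] (G : SimpleGraph V) (v : V) : ℕ :=
  ∑ u, G.dist v u

/-- The average distance of a vertex to all other vertices. -/
noncomputable def avgDist [Fintype V] (G : SimpleGraph V) (v : V) : ℝ :=
  (G.totalDist v : ℝ) / ((Fintype.card V : ℝ) - 1)

/-- The remoteness `ρ(G)`: the largest average distance of a vertex. -/
noncomputable def remoteness [Fintype V] (G : SimpleGraph V) : ℝ :=
  ⨆ v, G.avgDist v

end SimpleGraph

/-- The correction term for triangulations of order `n`. -/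
noncomputable def epsTriangulation (n : ℕ) : ℝ :=
  if n % 3 = 1 then 0 else 1 / (3 * ((n : ℝ) - 1))

/-- The correction term for 4-connected triangulations of order `n`. -/
noncomputable def epsFourConnected (n : ℕ) : ℝ :=
  if n % 4 = 1 then 0
  else if n % 4 = 3 then 1 / (2 * ((n : ℝ) - 1))
  else 3 / (8 * ((n : ℝ) - 1))

/-- The correction term for quadrangulations of order `n`. -/
noncomputable def epsQuadrangulation (n : ℕ) : ℝ :=
  if n % 2 = 1 then 0 else 1 / (4 * ((n : ℝ) - 1))

namespace SimpleGraph

/-! All three bounds come from one principle. If fewer than `m` vertices never separate a connected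
graph, every distance layer strictly between `v` and a farthest vertex has at least `m` vertices. So
at most `n - 1 - m * j` vertices lie farther than `j` from `v`, and summing over `j` bounds `σ(v)`.
The bound is attained when all intermediate layers have exactly `m` vertices; `remotenessBound m n`
is this value divided by `n - 1`.

The values of `m` are 3 for triangulations, 4 for 4-connected graphs and 2 for quadrangulations. For
plane graphs they are read off the rotation system: consecutive neighbours of a vertex are adjacent
(triangles), or have another common neighbour (4-cycles), so deleting the vertex leaves its
neighbours linked around it. `NoSeparator` imposes no minimum order, unlike `IsVertexConnected`, so
the smallest graphs need no separate treatment.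

For sharpness, explicit graphs on `0, …, n - 1` are used in which adjacent labels have values of `⌈j
/ m⌉` differing by at most 1; hence vertex 0 is at distance at least `⌈j / m⌉` from `j`. They are
shown to be plane by giving the rotation as arithmetic on labels, checking that all faces close up
after `k` steps, and counting edges to obtain Euler's formula. -/

theorem Connected.eq_of_forall_adj {V α : Type*} {G : SimpleGraph V} (hG : G.Connected)
    {f : V → α} (h : ∀ u v, G.Adj u v → f u = f v) (u v : V) : f u = f v := by
  obtain ⟨p⟩ := hG.preconnected u v
  induction p with
  | nil => rfl
  | cons hadj _ ih => exact (h _ _ hadj).trans ih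

/-- No set of fewer than `m` vertices separates two of the remaining vertices. -/
def NoSeparator {V : Type*} (G : SimpleGraph V) (m : ℕ) : Prop :=
  ∀ S : Finset V, S.card < m → ∀ P : V → Prop,
    (∀ u v, u ∉ S → v ∉ S → G.Adj u v → (P u ↔ P v)) → ∀ u v, u ∉ S → v ∉ S → (P u ↔ P v)

theorem IsVertexConnected.noSeparator {V : Type*} {G : SimpleGraph V} {m : ℕ}
    (hG : G.IsVertexConnected m) : G.NoSeparator m := by
  intro S hS P hP u v hu hv
  have h := (hG.2 S hS).eq_of_forall_adj (f := fun x => P x)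
    (fun x y hxy => propext (hP x y (Finset.mem_coe.not.1 x.2) (Finset.mem_coe.not.1 y.2) hxy))
    ⟨u, by simpa using hu⟩ ⟨v, by simpa using hv⟩
  exact iff_of_eq h

theorem Connected.le_add_dist {V : Type*} {G : SimpleGraph V} (hG : G.Connected) {f : V → ℕ}
    (hf : ∀ u v, G.Adj u v → f v ≤ f u + 1) (u v : V) : f v ≤ f u + G.dist u v := by
  obtain ⟨p, hp⟩ := hG.exists_walk_length_eq_dist u v
  rw [← hp]
  clear hp
  induction p with
  | nil => simp
  | cons h p ih =>
    have := hf _ _ h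
    simp only [Walk.length_cons]
    omega

/-! ### Distance layers and the common bound -/

section Layers

variable {V : Type*} [Fintype V] {G : SimpleGraph V} {m : ℕ}

/-- A smaller layer would separate `v` from `w`, because distances from `v` change by at most 1
along an edge. -/
theorem NoSeparator.le_card_layer (hm : G.NoSeparator m) (v w : V) {i : ℕ}
    (hi : 0 < i) (hw : i < G.dist v w) : m ≤ (Finset.univ.filter fun u => G.dist v u = i).card := by
  by_contra! hlt
  have h := hm _ hlt (fun u => G.dist v u < i) (fun u u' hu hu' hadj => by
    simp only [Finset.mem_filter, Finset.mem_univ, true_and] at hu hu'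
    have := hadj.diff_dist_adj (u := v)
    omega) v w (by simp; omega) (by simp; omega)
  simp at h
  omega

/-- If some vertex is farther than `j`, then layers `1, …, j` each have at least `m` vertices, and
`v` itself accounts for the 1. If none is, truncated subtraction makes the bound harmless. -/
theorem NoSeparator.card_far_le (hm : G.NoSeparator m) (v : V) (j : ℕ) :
    (Finset.univ.filter fun u => j < G.dist v u).card ≤ Fintype.card V - 1 - m * j := by
  rcases (Finset.univ.filter fun u => j < G.dist v u).eq_empty_or_nonempty with h | ⟨w, hw⟩
  · simp [h]
  simp only [Finset.mem_filter, Finset.mem_univ, true_and] at hw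
  suffices h : (Finset.univ.filter fun u => j < G.dist v u).card + m * j + 1 ≤ Fintype.card V by
    omega
  induction j with
  | zero =>
    have : (Finset.univ.filter fun u => 0 < G.dist v u) ⊂ Finset.univ :=
      Finset.filter_ssubset.2 ⟨v, Finset.mem_univ v, by simp⟩
    have := Finset.card_lt_card this
    simpa using this
  | succ j ih =>
    have h1 := ih (by omega)
    have h2 := hm.le_card_layer v w (i := j + 1) (by omega) hw
    have h3 : (Finset.univ.filter fun u => j < G.dist v u).card =
        (Finset.univ.filter fun u => G.dist v u = j + 1).card +
        (Finset.univ.filter fun u => j + 1 < G.dist v u).card := by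
      classical
      rw [← Finset.card_union_of_disjoint]
      · congr 1
        ext u
        simp
        omega
      · rw [Finset.disjoint_filter]
        intros
        omega
    rw [mul_add]
    omega

theorem NoSeparator.totalDist_le_sum (hm : G.NoSeparator m) (v : V) :
    G.totalDist v ≤ ∑ j ∈ Finset.range (G.totalDist v), (Fintype.card V - 1 - m * j) := by
  classical
  -- A vertex at distance `d` is counted once for each `j < d`. The total distance serves as a
  -- cutoff no single distance exceeds.
  have h : G.totalDist v = ∑ j ∈ Finset.range (G.totalDist v),
      (Finset.univ.filter fun u => j < G.dist v u).card := by
    simp_rw [Finset.card_filter]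
    rw [Finset.sum_comm]
    refine Finset.sum_congr rfl fun u _ => ?_
    have hu : G.dist v u ≤ G.totalDist v :=
      Finset.single_le_sum (f := fun u => G.dist v u) (fun _ _ => Nat.zero_le _) (Finset.mem_univ u)
    rw [← Finset.card_filter]
    have : (Finset.range (G.totalDist v)).filter (fun j => j < G.dist v u) =
        Finset.range (G.dist v u) := by
      ext j
      simp
      omega
    rw [this, Finset.card_range]
  conv_lhs => rw [h]
  exact Finset.sum_le_sum fun j _ => hm.card_far_le v j

/-- Removing the term `j = 0` turns the sum for `q + 1` into the sum for `q`. Terms beyond `j = q`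
vanish by truncation because `r < m`, so the bound is uniform in `D`. -/
theorem two_mul_sum_sub_mul_le (q r D : ℕ) (hr : r < m) :
    2 * ∑ j ∈ Finset.range D, (m * q + r - m * j) ≤ (q + 1) * (m * q + 2 * r) := by
  induction q generalizing D with
  | zero =>
    cases D with
    | zero => simp
    | succ D =>
      rw [Finset.sum_range_succ', Finset.sum_eq_zero]
      · simp
      · intro j _
        rw [mul_add]
        omega
  | succ q ih =>
    cases D with
    | zero => simp
    | succ D =>
      rw [Finset.sum_range_succ']
      have h : ∀ j ∈ Finset.range D, m * (q + 1) + r - m * (j + 1) = m * q + r - m * j := by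
        intro j _
        rw [mul_add, mul_add]
        omega
      rw [Finset.sum_congr rfl h]
      have := ih D
      simp only [mul_zero, Nat.sub_zero]
      nlinarith

/-- The largest possible remoteness of a graph of order `n` without separators of size less than
`m`: the value for which all distance layers but the first and the last have size `m`. -/
noncomputable def remotenessBound (m n : ℕ) : ℝ :=
  ((((n - 1) / m + 1) * (m * ((n - 1) / m) + 2 * ((n - 1) % m)) : ℕ) : ℝ) / (2 * ((n : ℝ) - 1))

theorem NoSeparator.remoteness_le (hG : G.Connected) (hm : G.NoSeparator m) (hm0 : 0 < m) :
    G.remoteness ≤ remotenessBound m (Fintype.card V) := by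
  have := hG.nonempty
  refine ciSup_le fun v => ?_
  have hn : 1 ≤ Fintype.card V := Fintype.card_pos
  have hn' : (1 : ℝ) ≤ Fintype.card V := by exact_mod_cast hn
  have h1 := hm.totalDist_le_sum v
  have h2 := two_mul_sum_sub_mul_le ((Fintype.card V - 1) / m) ((Fintype.card V - 1) % m)
    (G.totalDist v) (Nat.mod_lt _ hm0)
  rw [Nat.div_add_mod] at h2
  have h3 := (Nat.mul_le_mul_left 2 h1).trans h2
  have h4 := (Nat.cast_le (α := ℝ)).2 h3
  rw [avgDist, remotenessBound, ← mul_div_mul_left _ _ (two_ne_zero (α := ℝ))]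
  refine div_le_div_of_nonneg_right ?_ (by linarith)
  rw [← Nat.cast_two, ← Nat.cast_mul]
  exact h4

/-- The quotient is `⌈j / m⌉`. Allowing `r = m` lets the induction pass from `(q, m)` to `(q + 1,
0)`, which describe the same sum. -/
theorem two_mul_sum_ceil (hm0 : 0 < m) (q r : ℕ) (hr : r ≤ m) :
    2 * ∑ j ∈ Finset.range (m * q + r + 1), (j + m - 1) / m = (q + 1) * (m * q + 2 * r) := by
  induction q generalizing r with
  | zero =>
    induction r with
    | zero => simp; omega
    | succ r ih =>
      have := ih (by omega)
      rw [← add_assoc, Finset.sum_range_succ, mul_add, this]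
      have : (m * 0 + r + 1 + m - 1) / m = 1 := by
        rw [Nat.div_eq_iff hm0]
        omega
      rw [this]
      ring
  | succ q ih =>
    induction r with
    | zero =>
      have := ih m le_rfl
      rw [mul_add, mul_one, add_zero, this]
      ring
    | succ r ih' =>
      have := ih' (by omega)
      rw [← add_assoc, Finset.sum_range_succ, mul_add, this]
      have : (m * (q + 1) + r + 1 + m - 1) / m = q + 2 := by
        rw [Nat.div_eq_iff hm0, mul_comm (q + 2), mul_add m q 2]
        rw [mul_add]
        omega
      rw [this]
      ring

/-- The function `⌈j / m⌉` vanishes at 0 and rises by at most 1 along an edge, so it is a lower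
bound for the distance from 0. -/
theorem le_remoteness_of_ceil {n : ℕ} (G : SimpleGraph (Fin n)) (hG : G.Connected) (hm0 : 0 < m)
    (h : ∀ i j, G.Adj i j → ((j : ℕ) + m - 1) / m ≤ ((i : ℕ) + m - 1) / m + 1) :
    remotenessBound m n ≤ G.remoteness := by
  have hn : 0 < n := by
    obtain ⟨i⟩ := hG.nonempty
    exact i.pos
  have hn' : (1 : ℝ) ≤ n := by exact_mod_cast hn
  refine le_trans ?_ (le_ciSup (f := fun v => G.avgDist v) (Set.finite_range _).bddAbove ⟨0, hn⟩)
  rw [avgDist, remotenessBound, ← mul_div_mul_left (G.totalDist _ : ℝ) _ (two_ne_zero (α := ℝ)),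
    Fintype.card_fin]
  refine div_le_div_of_nonneg_right ?_ (by linarith)
  rw [← Nat.cast_ofNat (R := ℝ), ← Nat.cast_mul 2 (G.totalDist _), Nat.cast_le,
    ← two_mul_sum_ceil hm0 _ _ (Nat.mod_lt _ hm0).le, Nat.div_add_mod, Nat.sub_add_cancel hn,
    Finset.sum_range]
  refine Nat.mul_le_mul_left 2 (Finset.sum_le_sum fun j _ => ?_)
  have := hG.le_add_dist h ⟨0, hn⟩ j
  have h0 : (0 + m - 1) / m = 0 := Nat.div_eq_of_lt (by omega)
  simp only [h0] at this
  omega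

end Layers

/-! ### Closed forms of the bound by residue class -/

theorem remotenessBound_three {n : ℕ} (hn : 2 ≤ n) :
    remotenessBound 3 n = ((n : ℝ) + 2) / 6 + epsTriangulation n := by
  obtain ⟨N, rfl⟩ : ∃ N, n = N + 1 := ⟨n - 1, by omega⟩
  have hN : (N : ℝ) ≠ 0 := by
    rw [Nat.cast_ne_zero]
    omega
  have hr : N % 3 < 3 := Nat.mod_lt _ (by norm_num)
  have hq : N = 3 * (N / 3) + N % 3 := (Nat.div_add_mod _ _).symm
  generalize N / 3 = q at hq
  rw [remotenessBound, epsTriangulation]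
  have h1 : (N + 1 - 1) / 3 = q := by omega
  have h2 : (N + 1 - 1) % 3 = N % 3 := by omega
  rw [h1, h2]
  have hqR : (N : ℝ) = 3 * q + (N % 3 : ℕ) := by exact_mod_cast hq
  split_ifs with h
  all_goals push_cast
  all_goals simp only [add_sub_cancel_right]
  · have : N % 3 = 0 := by omega
    rw [this] at hqR ⊢
    field_simp
    rw [hqR]
    push_cast
    ring
  · obtain h | h : N % 3 = 1 ∨ N % 3 = 2 := by omega
    all_goals
      rw [h] at hqR ⊢
      field_simp
      rw [hqR]
      push_cast
      ring

theorem remotenessBound_four {n : ℕ} (hn : 2 ≤ n) :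
    remotenessBound 4 n = ((n : ℝ) + 3) / 8 + epsFourConnected n := by
  obtain ⟨N, rfl⟩ : ∃ N, n = N + 1 := ⟨n - 1, by omega⟩
  have hN : (N : ℝ) ≠ 0 := by
    rw [Nat.cast_ne_zero]
    omega
  have hr : N % 4 < 4 := Nat.mod_lt _ (by norm_num)
  have hq : N = 4 * (N / 4) + N % 4 := (Nat.div_add_mod _ _).symm
  generalize N / 4 = q at hq
  rw [remotenessBound, epsFourConnected]
  have h1 : (N + 1 - 1) / 4 = q := by omega
  have h2 : (N + 1 - 1) % 4 = N % 4 := by omega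
  rw [h1, h2]
  have hqR : (N : ℝ) = 4 * q + (N % 4 : ℕ) := by exact_mod_cast hq
  split_ifs with h h'
  all_goals push_cast
  all_goals simp only [add_sub_cancel_right]
  · have : N % 4 = 0 := by omega
    rw [this] at hqR ⊢
    field_simp
    rw [hqR]
    push_cast
    ring
  · have : N % 4 = 2 := by omega
    rw [this] at hqR ⊢
    field_simp
    rw [hqR]
    push_cast
    ring
  · obtain h | h : N % 4 = 1 ∨ N % 4 = 3 := by omega
    all_goals
      rw [h] at hqR ⊢
      field_simp
      rw [hqR]
      push_cast
      ring

theorem remotenessBound_two {n : ℕ} (hn : 2 ≤ n) :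
    remotenessBound 2 n = ((n : ℝ) + 1) / 4 + epsQuadrangulation n := by
  obtain ⟨N, rfl⟩ : ∃ N, n = N + 1 := ⟨n - 1, by omega⟩
  have hN : (N : ℝ) ≠ 0 := by
    rw [Nat.cast_ne_zero]
    omega
  have hq : N = 2 * (N / 2) + N % 2 := (Nat.div_add_mod _ _).symm
  generalize N / 2 = q at hq
  rw [remotenessBound, epsQuadrangulation]
  have h1 : (N + 1 - 1) / 2 = q := by omega
  have h2 : (N + 1 - 1) % 2 = N % 2 := by omega
  rw [h1, h2]
  have hqR : (N : ℝ) = 2 * q + (N % 2 : ℕ) := by exact_mod_cast hq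
  split_ifs with h
  all_goals push_cast
  all_goals simp only [add_sub_cancel_right]
  · have : N % 2 = 0 := by omega
    rw [this] at hqR ⊢
    field_simp
    rw [hqR]
    push_cast
    ring
  · have : N % 2 = 1 := by omega
    rw [this] at hqR ⊢
    field_simp
    rw [hqR]
    push_cast
    ring

/-! ### Separators in triangulations and quadrangulations -/

namespace PlaneEmbedding

variable {V : Type*} {G : SimpleGraph V} (M : G.PlaneEmbedding)

theorem rot_fst (d : G.Dart) : (M.rot d).fst = d.fst :=
  (M.isCycleOn_rot d.fst).1.mapsTo rfl

theorem facePerm_fst (d : G.Dart) : (facePerm M.rot d).fst = d.snd :=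
  M.rot_fst d.symm

theorem facePerm_symm (d : G.Dart) : facePerm M.rot d.symm = M.rot d := by
  simp [facePerm, Function.Involutive.toPerm]

theorem facePerm_snd (d : G.Dart) :
    (facePerm M.rot d).snd = (facePerm M.rot (facePerm M.rot d)).fst :=
  (M.facePerm_fst _).symm

/-- Two neighbours of `a` that are consecutive in the rotation at `a` are joined by an edge if the
face between them is a triangle. -/
theorem AllFacesCycles.adj_rot {M : G.PlaneEmbedding} (h : M.AllFacesCycles 3) (d : G.Dart) :
    G.Adj d.snd (M.rot d).snd := by
  have h3 := (h d.symm).1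
  rw [pow_succ', pow_two] at h3
  simp only [Equiv.Perm.mul_apply, facePerm_symm] at h3
  have h2 := (facePerm M.rot (M.rot d)).adj
  rw [M.facePerm_fst, M.facePerm_snd, h3] at h2
  exact h2.symm

/-- Two neighbours of `a` that are consecutive in the rotation at `a` have a common neighbour other
than `a` if the face between them is a `4`-cycle. -/
theorem AllFacesCycles.exists_adj_rot {M : G.PlaneEmbedding} (h : M.AllFacesCycles 4)
    (d : G.Dart) : ∃ x, x ≠ d.fst ∧ G.Adj d.snd x ∧ G.Adj x (M.rot d).snd := by
  have h4 := (h d.symm).1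
  have hi := (h d.symm).2.ne (x := 1) (y := 3) (by simp) (by simp) (by simp)
  rw [pow_succ', pow_succ', pow_two] at h4
  simp only [pow_succ', pow_zero, mul_one, Equiv.Perm.mul_apply, facePerm_symm, M.rot_fst] at h4 hi
  refine ⟨_, hi.symm, ?_, ?_⟩
  · have h3 := (facePerm M.rot (facePerm M.rot (M.rot d))).adj
    rw [M.facePerm_snd, h4] at h3
    exact h3.symm
  · have h2 := (facePerm M.rot (M.rot d)).adj
    rw [M.facePerm_fst, M.facePerm_snd] at h2
    exact h2.symm

variable [Fintype V]

/-- With at most one vertex there are no darts, hence no face orbits, contradicting Euler's formula.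
This keeps the denominator `n - 1` nonzero. -/
theorem one_lt_card (M : G.PlaneEmbedding) : 1 < Fintype.card V := by
  by_contra! h
  have := Fintype.card_le_one_iff_subsingleton.1 h
  have : IsEmpty G.Dart := ⟨fun d => d.fst_ne_snd (Subsingleton.elim _ _)⟩
  have he := M.euler
  have : Nat.card (Quotient (Equiv.Perm.SameCycle.setoid (facePerm M.rot))) = 0 := by
    simp
  rw [Nat.card_eq_fintype_card] at he
  omega

/-- A property that passes between consecutive darts at `a`, except possibly at `d₀`, is constant
on the other darts at `a`. -/
theorem dart_induction {a : V} {P : G.Dart → Prop} {d₀ : G.Dart} (h₀ : d₀.fst = a)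
    (hP : ∀ d : G.Dart, d.fst = a → d ≠ d₀ → M.rot d ≠ d₀ → (P d ↔ P (M.rot d)))
    {d : G.Dart} (hd : d.fst = a) : d = d₀ ∨ (P d ↔ P (M.rot d₀)) := by
  classical
  obtain ⟨i, rfl⟩ := ((M.isCycleOn_rot a).2 h₀ hd).exists_nat_pow_eq
  clear hd
  induction i with
  | zero => exact Or.inl rfl
  | succ i ih =>
    have hfst : ((M.rot ^ i) d₀).fst = a :=
      (((M.isCycleOn_rot a).1.perm_pow i).mapsTo h₀)
    rw [pow_succ', Equiv.Perm.mul_apply]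
    by_cases h : (M.rot ^ i) d₀ = d₀
    · rw [h]
      exact Or.inr Iff.rfl
    · by_cases h' : M.rot ((M.rot ^ i) d₀) = d₀
      · exact Or.inl h'
      · exact Or.inr ((hP _ hfst h h').symm.trans (ih.resolve_left h))

/-- After deleting `a`, consecutive neighbours of `a` remain joined through the opposite corner of
their common face, so all neighbours of `a` stay in one component. -/
theorem AllFacesCycles.noSeparator_two {M : G.PlaneEmbedding} (h : M.AllFacesCycles 4) :
    G.NoSeparator 2 := by
  classical
  intro S hS P hP
  obtain hS | hS : S.card = 0 ∨ S.card = 1 := by omega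
  · rw [Finset.card_eq_zero] at hS
    subst hS
    intro u v _ _
    exact iff_of_eq (M.connected.eq_of_forall_adj
      (fun u v huv => propext (hP u v (by simp) (by simp) huv)) u v)
  obtain ⟨a, rfl⟩ := Finset.card_eq_one.1 hS
  simp only [Finset.mem_singleton] at hP ⊢
  have key : ∀ x y, G.Adj a x → G.Adj a y → (P x ↔ P y) := by
    have step : ∀ d : G.Dart, d.fst = a → (P d.snd ↔ P (M.rot d).snd) := by
      rintro d rfl
      obtain ⟨x, hx, h1, h2⟩ := h.exists_adj_rot d
      exact (hP _ _ d.snd_ne_fst hx h1).trans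
        (hP _ _ hx (M.rot_fst d ▸ (M.rot d).snd_ne_fst) h2)
    intro x y hx hy
    rcases M.dart_induction (d₀ := ⟨(a, x), hx⟩) (P := fun d => P d.snd) rfl
      (fun d hd _ _ => step d hd) (d := ⟨(a, y), hy⟩) rfl with h | h
    · have hyx : y = x := (Prod.ext_iff.1 ((Dart.ext_iff _ _).1 h)).2
      rw [hyx]
    · exact (step ⟨(a, x), hx⟩ rfl).trans h.symm
  intro u v hu hv
  -- Giving `a` the common value of its neighbours extends `P` to a function constant along all
  -- edges of the connected graph.
  have hc := M.connected.eq_of_forall_adj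
    (f := fun u => if u = a then ∃ x, G.Adj a x ∧ P x else P u) (fun u v huv => ?_) u v
  · simpa [hu, hv] using hc
  · have := huv.ne
    split_ifs with h1 h2 h2
    · exact absurd (h1.trans h2.symm) this
    · subst h1
      exact propext ⟨fun ⟨x, hx, hPx⟩ => (key x v hx huv).1 hPx, fun hv => ⟨v, huv, hv⟩⟩
    · subst h2
      exact propext ⟨fun hu => ⟨u, huv.symm, hu⟩, fun ⟨x, hx, hPx⟩ => (key x u hx huv.symm).1 hPx⟩
    · exact propext (hP u v h1 h2 huv)

/-- The neighbours of `a` form a closed walk in rotation order; deleting `b` cuts it in at most one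
place, so the others stay linked. The same holds around `b`, and `P` extends to both deleted
vertices. -/
theorem AllFacesCycles.noSeparator_three {M : G.PlaneEmbedding} (h : M.AllFacesCycles 3) :
    G.NoSeparator 3 := by
  classical
  intro S hS P hP
  rcases S.eq_empty_or_nonempty with rfl | hne
  · intro u v _ _
    exact iff_of_eq (M.connected.eq_of_forall_adj
      (fun u v huv => propext (hP u v (by simp) (by simp) huv)) u v)
  obtain ⟨a, b, rfl⟩ : ∃ a b, S = {a, b} := by
    obtain hS | hS : S.card = 1 ∨ S.card = 2 := by
      have := hne.card_pos
      omega
    -- A single deleted vertex is the case `a = b`, handled below as a nonadjacent pair.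
    · obtain ⟨a, rfl⟩ := Finset.card_eq_one.1 hS
      exact ⟨a, a, by simp⟩
    · obtain ⟨a, b, _, rfl⟩ := Finset.card_eq_two.1 hS
      exact ⟨a, b, rfl⟩
  simp only [Finset.mem_insert, Finset.mem_singleton, not_or] at hP ⊢
  have key : ∀ a b : V, (∀ u v, (u ≠ a ∧ u ≠ b) → (v ≠ a ∧ v ≠ b) → G.Adj u v → (P u ↔ P v)) →
      ∀ x y, G.Adj a x → G.Adj a y → x ≠ b → y ≠ b → (P x ↔ P y) := by
    intro a b hP
    have step : ∀ d : G.Dart, d.fst = a → d.snd ≠ b → (M.rot d).snd ≠ b →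
        (P d.snd ↔ P (M.rot d).snd) := by
      rintro d rfl h1 h2
      exact hP _ _ ⟨d.snd_ne_fst, h1⟩ ⟨M.rot_fst d ▸ (M.rot d).snd_ne_fst, h2⟩ (h.adj_rot d)
    have inj : ∀ d : G.Dart, d.fst = a → ∀ hb : G.Adj a b, d ≠ ⟨(a, b), hb⟩ → d.snd ≠ b :=
      fun d hd hb hne hdb => hne (Dart.ext _ _ (Prod.ext hd hdb))
    intro x y hx hy hxb hyb
    by_cases hab : G.Adj a b
    · have hc : ∀ z (hz : G.Adj a z), z ≠ b → (P z ↔ P (M.rot ⟨(a, b), hab⟩).snd) := by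
        intro z hz hzb
        refine (M.dart_induction (d₀ := ⟨(a, b), hab⟩) (P := fun d => P d.snd) rfl
          (fun d hd h1 h2 => step d hd (inj d hd hab h1)
            (inj _ ((M.rot_fst d).trans hd) hab h2)) (d := ⟨(a, z), hz⟩) rfl).resolve_left ?_
        intro he
        exact hzb (Prod.ext_iff.1 ((Dart.ext_iff _ _).1 he)).2
      exact (hc x hx hxb).trans (hc y hy hyb).symm
    · have hnb : ∀ d : G.Dart, d.fst = a → d.snd ≠ b := by
        rintro d rfl rfl
        exact hab d.adj
      have step' : ∀ d : G.Dart, d.fst = a → (P d.snd ↔ P (M.rot d).snd) :=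
        fun d hd => step d hd (hnb d hd) (hnb _ ((M.rot_fst d).trans hd))
      rcases M.dart_induction (d₀ := ⟨(a, x), hx⟩) (P := fun d => P d.snd) rfl
        (fun d hd _ _ => step' d hd) (d := ⟨(a, y), hy⟩) rfl with h | h
      · have hyx : y = x := (Prod.ext_iff.1 ((Dart.ext_iff _ _).1 h)).2
        rw [hyx]
      · exact (step' ⟨(a, x), hx⟩ rfl).trans h.symm
  have keya := key a b hP
  have keyb := key b a fun u v hu hv => hP u v hu.symm hv.symm
  intro u v hu hv
  by_cases hab : G.Adj a b
  -- The third corner `c` of a face at the edge `ab` forces the values assigned to `a` and `b` to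
  -- agree.
  · obtain ⟨c, hac, hbc⟩ : ∃ c, G.Adj a c ∧ G.Adj b c := by
      have hadj := (M.rot ⟨(a, b), hab⟩).adj
      rw [M.rot_fst] at hadj
      exact ⟨_, hadj, h.adj_rot ⟨(a, b), hab⟩⟩
    have hc := M.connected.eq_of_forall_adj
      (f := fun u => if u = a ∨ u = b then P c else P u) (fun u v huv => ?_) u v
    · simpa [hu, hv] using hc
    · have aux : ∀ u v, (u = a ∨ u = b) → ¬(v = a ∨ v = b) → G.Adj u v → (P c ↔ P v) := by
        intro u v hu hv huv
        rw [not_or] at hv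
        rcases hu with rfl | rfl
        · exact keya c v hac huv hbc.ne' hv.2
        · exact keyb c v hbc huv hac.ne' hv.1
      split_ifs with h1 h2 h2
      · rfl
      · exact propext (aux u v h1 h2 huv)
      · exact propext (aux v u h2 h1 huv.symm).symm
      · rw [not_or] at h1 h2
        exact propext (hP u v h1 h2 huv)
  · have hc := M.connected.eq_of_forall_adj
      (f := fun u => if u = a ∨ u = b then ∃ x, G.Adj u x ∧ P x else P u) (fun u v huv => ?_) u v
    · simpa [hu, hv] using hc
    · have aux : ∀ u v, (u = a ∨ u = b) → ¬(v = a ∨ v = b) → G.Adj u v →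
          ((∃ x, G.Adj u x ∧ P x) ↔ P v) := by
        intro u v hu hv huv
        rw [not_or] at hv
        refine ⟨fun ⟨x, hx, hPx⟩ => ?_, fun h => ⟨v, huv, h⟩⟩
        rcases hu with rfl | rfl
        · exact (keya x v hx huv (by rintro rfl; exact hab hx) hv.2).1 hPx
        · exact (keyb x v hx huv (by rintro rfl; exact hab hx.symm) hv.1).1 hPx
      split_ifs with h1 h2 h2
      · exfalso
        rcases h1 with rfl | rfl <;> rcases h2 with rfl | rfl
        · exact huv.ne rfl
        · exact hab huv
        · exact hab huv.symm
        · exact huv.ne rfl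
      · exact propext (aux u v h1 h2 huv)
      · exact propext (aux v u h2 h1 huv.symm).symm
      · rw [not_or] at h1 h2
        exact propext (hP u v h1 h2 huv)

end PlaneEmbedding

/-! ### Plane embeddings from local rules -/

/-- If all orbits of the face permutation are `k`-cycles, then their number is determined by the
number of darts. -/
theorem mul_card_faces {V : Type*} [Finite V] {G : SimpleGraph V} {f : Equiv.Perm G.Dart} {k : ℕ}
    (hk : 0 < k) (hf : ∀ d, (f ^ k) d = d)
    (hinj : ∀ d, Set.InjOn (fun i : ℕ => ((f ^ i) d).fst) (Set.Iio k)) :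
    k * Nat.card (Quotient (Equiv.Perm.SameCycle.setoid f)) = 2 * Nat.card G.edgeSet := by
  classical
  have := Fintype.ofFinite V
  have hdart : Nat.card G.Dart = 2 * Nat.card G.edgeSet := by
    rw [Nat.card_eq_fintype_card, G.dart_card_eq_twice_card_edges, Nat.card_eq_fintype_card,
      edgeFinset_card]
  rw [← hdart, ← Nat.card_fin k, mul_comm, ← Nat.card_prod]
  have hsame : ∀ q : Quotient (Equiv.Perm.SameCycle.setoid f), ∀ i : ℕ,
      Quotient.mk _ ((f ^ i) q.out) = q := fun q i => by
    conv_rhs => rw [← q.out_eq]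
    exact Quotient.sound (Equiv.Perm.sameCycle_pow_left.2 Equiv.Perm.SameCycle.rfl)
  -- A dart is determined by its face orbit and its position below `k` from a chosen representative;
  -- distinct starting vertices make the position unique.
  refine Nat.card_eq_of_bijective (fun p => (f ^ (p.2 : ℕ)) p.1.out) ⟨?_, fun d => ?_⟩
  · rintro ⟨q, i⟩ ⟨q', i'⟩ h
    have hq : q = q' := by
      rw [← hsame q i, ← hsame q' i']
      exact congrArg _ h
    subst hq
    have hi := hinj q.out i.2 i'.2 (congrArg (fun d : G.Dart => d.fst) h)
    rw [Fin.ext hi]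
  · obtain ⟨n, hn⟩ := (Quotient.mk_out (s := Equiv.Perm.SameCycle.setoid f) d).exists_nat_pow_eq
    refine ⟨(Quotient.mk _ d, ⟨n % k, Nat.mod_lt _ hk⟩), ?_⟩
    rw [pow_eq_pow_mod n (Equiv.ext hf : f ^ k = 1)] at hn
    exact hn

/-- A rotation system given by a function `next`: the neighbour `next v u` of `v` follows the
neighbour `u` in the rotation at `v`. If the face maps `(u, v) ↦ (v, next v u)` all have order `k`,
then they form the faces of a plane embedding as soon as the number of edges is correct. -/
theorem exists_planeEmbedding_of_next {V : Type*} [Finite V] {G : SimpleGraph V}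
    (hG : G.Connected) {k : ℕ} (hk : 0 < k) (face : G.Dart → G.Dart)
    (hfst : ∀ d, (face d).fst = d.snd) (hface : ∀ d, face^[k] d = d)
    (hinj : ∀ d, Set.InjOn (fun i : ℕ => (face^[i] d).fst) (Set.Iio k))
    (base : V → V) (rank : G.Dart → ℕ)
    (hrank : ∀ d : G.Dart, d.snd = base d.fst ∨ rank (face d.symm) < rank d)
    (hcard : 2 * Nat.card G.edgeSet + k * Nat.card V = k * (Nat.card G.edgeSet + 2)) :
    ∃ M : G.PlaneEmbedding, M.AllFacesCycles k := by
  have hl : ∀ d, face (face^[k - 1] d) = d := fun d => by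
    rw [← Function.iterate_succ_apply' face, Nat.succ_eq_add_one, Nat.sub_add_cancel hk, hface]
  have hr : ∀ d, face^[k - 1] (face d) = d := fun d => by
    rw [← Function.iterate_succ_apply face, Nat.succ_eq_add_one, Nat.sub_add_cancel hk, hface]
  let f : Equiv.Perm G.Dart := ⟨face, face^[k - 1], hr, hl⟩
  let s : Equiv.Perm G.Dart := Function.Involutive.toPerm Dart.symm Dart.symm_involutive
  have hs : s * s = 1 := by
    ext1 d
    exact d.symm_symm
  -- The rotation is recovered as face map after reversal; the two reversals in `facePerm` cancel.
  have hfs : facePerm (f * s) = f := by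
    rw [facePerm, mul_assoc]
    exact (congrArg (f * ·) hs).trans (mul_one f)
  have hpow : ∀ i d, (f ^ i) d = face^[i] d := fun i d => by
    rw [Equiv.Perm.coe_pow]
    rfl
  have hrot : ∀ d, ((f * s) d).fst = d.fst := fun d => hfst d.symm
  -- `rank` falls with each turn of the rotation until the dart towards `base` is reached, so all
  -- darts at a vertex share a cycle with that one.
  have hbase : ∀ r, ∀ d : G.Dart, rank d = r →
      ∃ e : G.Dart, (f * s).SameCycle d e ∧ e.fst = d.fst ∧ e.snd = base d.fst := by
    intro r
    induction r using Nat.strong_induction_on with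
    | _ r ih =>
      intro d hd
      rcases hrank d with h | h
      · exact ⟨d, Equiv.Perm.SameCycle.rfl, rfl, h⟩
      · obtain ⟨e, h1, h2, h3⟩ := ih _ (hd ▸ h) _ rfl
        refine ⟨e, ?_, h2.trans (hrot d), h3.trans (congrArg base (hrot d))⟩
        exact (Equiv.Perm.sameCycle_apply_left (f := f * s) (x := d)).1 h1
  have hfk : ∀ d, (facePerm (f * s) ^ k) d = d := fun d => by rw [hfs, hpow, hface]
  have hfi : ∀ d, Set.InjOn (fun i : ℕ => ((facePerm (f * s) ^ i) d).fst) (Set.Iio k) := fun d => by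
    simpa only [hfs, hpow] using hinj d
  refine ⟨⟨f * s, fun v => ⟨⟨fun d hd => (hrot d).trans hd, (f * s).injective.injOn, fun d hd =>
    ⟨(f * s)⁻¹ d, ?_, by simp⟩⟩, ?_⟩, hG, ?_⟩, fun d => ⟨hfk d, hfi d⟩⟩
  · have := hrot ((f * s)⁻¹ d)
    rw [← Equiv.Perm.mul_apply, mul_inv_cancel] at this
    exact this.symm.trans hd
  · rintro d rfl d' hd'
    obtain ⟨e, h1, h2, h3⟩ := hbase _ d rfl
    obtain ⟨e', h1', h2', h3'⟩ := hbase _ d' rfl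
    have hd'' : d'.fst = d.fst := hd'
    have : e = e' := Dart.ext _ _ (Prod.ext (h2.trans (hd''.symm.trans h2'.symm))
      (h3.trans ((congrArg base hd''.symm).trans h3'.symm)))
    exact h1.trans (this ▸ h1'.symm)
  -- Multiplied by `k`, Euler's formula becomes `hcard`, since `k` times the number of faces is
  -- twice the number of edges.
  · have := mul_card_faces hk hfk hfi
    refine Nat.eq_of_mul_eq_mul_left hk ?_
    rw [mul_add, this]
    linarith

/-! ### Graphs on initial segments of the natural numbers -/

section NatGraph

variable {n : ℕ} {G : SimpleGraph (Fin n)} {A : ℕ → ℕ → Prop} (hA : ∀ i j : Fin n, G.Adj i j ↔ A i j)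

include hA

/-- Each edge is counted at its larger endpoint. -/
theorem card_edgeSet_eq_sum [∀ i j, Decidable (A i j)] :
    Nat.card G.edgeSet = ∑ j ∈ Finset.range n, ((Finset.range j).filter fun i => A i j).card := by
  classical
  rw [Nat.card_eq_fintype_card, ← edgeFinset_card, ← Finset.card_sigma]
  symm
  have h : ∀ x ∈ (Finset.range n).sigma fun j => (Finset.range j).filter fun i => A i j,
      x.1 < n ∧ x.2 < x.1 ∧ A x.2 x.1 := fun x hx => by simpa using hx
  refine Finset.card_bij (fun x hx => s(⟨x.2, (h x hx).2.1.trans (h x hx).1⟩, ⟨x.1, (h x hx).1⟩))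
    (fun x hx => ?_) (fun x hx y hy hxy => ?_) (fun e he => ?_)
  · rw [mem_edgeFinset, mem_edgeSet, hA]
    exact (h x hx).2.2
  · have h1 := (h x hx).2.1
    have h2 := (h y hy).2.1
    obtain ⟨x1, x2⟩ := x
    obtain ⟨y1, y2⟩ := y
    simp only [Sym2.eq_iff, Fin.mk.injEq] at hxy h1 h2
    obtain ⟨rfl, rfl⟩ : x1 = y1 ∧ x2 = y2 := by omega
    rfl
  · rw [mem_edgeFinset] at he
    induction e using Sym2.ind with
    | _ i j =>
      rw [mem_edgeSet] at he
      rcases lt_or_gt_of_ne he.ne with hij | hij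
      · exact ⟨⟨j, i⟩, by simp [(hA i j).1 he, hij], rfl⟩
      · exact ⟨⟨i, j⟩, by simp [(hA j i).1 he.symm, hij], Sym2.eq_swap⟩

theorem connected_of_forall_exists_lt (hn : 0 < n)
    (h : ∀ j < n, 0 < j → ∃ i < j, A i j) : G.Connected := by
  have h0 : ∀ m (hm : m < n), G.Reachable ⟨0, hn⟩ ⟨m, hm⟩ := by
    intro m
    induction m using Nat.strong_induction_on with
    | _ m ih =>
      intro hm
      rcases Nat.eq_zero_or_pos m with rfl | hpos
      · rfl
      · obtain ⟨i, hi, hadj⟩ := h m hm hpos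
        exact (ih i hi (hi.trans hm)).trans ((hA ⟨i, hi.trans hm⟩ ⟨m, hm⟩).2 hadj).reachable
  have : Nonempty (Fin n) := ⟨⟨0, hn⟩⟩
  exact ⟨fun u v => (h0 u u.2).symm.trans (h0 v v.2)⟩

variable (hG : G.Connected) (next : ℕ → ℕ → ℕ)
  (hnext : ∀ i < n, ∀ j < n, A i j → next i j < n ∧ A i (next i j))
  (base : ℕ → ℕ) (rank : ℕ → ℕ → ℕ)
  (hrank : ∀ i < n, ∀ j < n, A i j → j = base i ∨ rank i (next i j) < rank i j)

include hG hnext hrank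

theorem isSimpleTriangulation_of_next
    (h3 : ∀ i < n, ∀ j < n, A i j → next (next j i) j = i)
    (hcard : Nat.card G.edgeSet + 6 = 3 * n) : G.IsSimpleTriangulation := by
  have hd : ∀ d : G.Dart, A d.snd d.fst := fun d => (hA _ _).1 d.adj.symm
  have hd' := fun d => hnext d.snd d.snd.2 d.fst d.fst.2 (hd d)
  let face : G.Dart → G.Dart := fun d => ⟨(d.snd, ⟨next d.snd d.fst, (hd' d).1⟩),
    (hA _ _).2 (hd' d).2⟩
  have hface : ∀ d, face (face (face d)) = d := fun d => by
    have h := h3 d.fst d.fst.2 d.snd d.snd.2 ((hA _ _).1 d.adj)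
    -- The closing condition gives only the third corner; applied to the next dart of the face it
    -- also gives the return to `d.snd`.
    have h' := h3 d.snd d.snd.2 (next d.snd d.fst) (hd' d).1 (hd' d).2
    rw [h] at h'
    refine Dart.ext _ _ (Prod.ext (Fin.ext h) (Fin.ext ?_))
    change next (next (next d.snd d.fst) d.snd) (next d.snd d.fst) = d.snd
    rw [h, h']
  refine exists_planeEmbedding_of_next hG (k := 3) (by norm_num) face (fun _ => rfl) hface
    (fun d => ?_) (fun i => if h : base i < n then ⟨base i, h⟩ else i)
    (fun d => rank d.fst d.snd) (fun d => ?_) ?_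
  · have h0 : ∀ d, (face d).fst ≠ d.fst := fun d => d.snd_ne_fst
    have h1 : (face (face d)).fst ≠ d.fst := fun h => by
      have := h0 (face (face d))
      rw [hface] at this
      exact this h.symm
    intro i hi j hj hij
    simp only [Set.mem_Iio] at hi hj
    interval_cases i <;> interval_cases j <;> first | rfl | (exfalso; simp at hij)
    · exact h0 d hij.symm
    · exact h1 hij.symm
    · exact h0 d hij
    · exact h0 _ hij.symm
    · exact h1 hij
    · exact h0 _ hij
  · refine (hrank d.fst d.fst.2 d.snd d.snd.2 ((hA _ _).1 d.adj)).imp (fun h => ?_) id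
    rw [dif_pos (h ▸ d.snd.2)]
    exact Fin.ext h
  · rw [Nat.card_eq_fintype_card (α := Fin n), Fintype.card_fin]
    omega

/-- Consecutive corners of a face differ because there are no loops; `hne` is what keeps opposite
corners distinct. -/
theorem isSimpleQuadrangulation_of_next
    (hne : ∀ i < n, ∀ j < n, A i j → next j i ≠ i)
    (h4 : ∀ i < n, ∀ j < n, A i j → next (next (next j i) j) (next j i) = i)
    (hcard : Nat.card G.edgeSet + 4 = 2 * n) : G.IsSimpleQuadrangulation := by
  have hd : ∀ d : G.Dart, A d.snd d.fst := fun d => (hA _ _).1 d.adj.symm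
  have hd' := fun d => hnext d.snd d.snd.2 d.fst d.fst.2 (hd d)
  let face : G.Dart → G.Dart := fun d => ⟨(d.snd, ⟨next d.snd d.fst, (hd' d).1⟩),
    (hA _ _).2 (hd' d).2⟩
  have hface' : ∀ d, (face (face (face d))).snd = d.fst := fun d =>
    Fin.ext (h4 d.fst d.fst.2 d.snd d.snd.2 ((hA _ _).1 d.adj))
  have hface : ∀ d, face (face (face (face d))) = d := fun d =>
    Dart.ext _ _ (Prod.ext (hface' d) (hface' (face d)))
  refine exists_planeEmbedding_of_next hG (k := 4) (by norm_num) face (fun _ => rfl) hface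
    (fun d => ?_) (fun i => if h : base i < n then ⟨base i, h⟩ else i)
    (fun d => rank d.fst d.snd) (fun d => ?_) ?_
  · have h0 : ∀ d, (face d).fst ≠ d.fst := fun d => d.snd_ne_fst
    have h1 : ∀ d, (face (face d)).fst ≠ d.fst := fun d h =>
      hne d.fst d.fst.2 d.snd d.snd.2 ((hA _ _).1 d.adj) (congrArg Fin.val h)
    have h2 : (face (face (face d))).fst ≠ d.fst := fun h => by
      have := h0 (face (face (face d)))
      rw [hface] at this
      exact this h.symm
    intro i hi j hj hij
    simp only [Set.mem_Iio] at hi hj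
    interval_cases i <;> interval_cases j <;> first | rfl | (exfalso; simp at hij)
    · exact h0 d hij.symm
    · exact h1 d hij.symm
    · exact h2 hij.symm
    · exact h0 d hij
    · exact h0 _ hij.symm
    · exact h1 _ hij.symm
    · exact h1 d hij
    · exact h0 _ hij
    · exact h0 _ hij.symm
    · exact h2 hij
    · exact h1 _ hij
    · exact h0 _ hij
  · refine (hrank d.fst d.fst.2 d.snd d.snd.2 ((hA _ _).1 d.adj)).imp (fun h => ?_) id
    rw [dif_pos (h ▸ d.snd.2)]
    exact Fin.ext h
  · rw [Nat.card_eq_fintype_card (α := Fin n), Fintype.card_fin]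
    omega

end NatGraph

/-! ### Extremal triangulations -/

/-- Adjacency in the third power of a path with vertices numbered consecutively. -/
abbrev PathCubeAdj (i j : ℕ) : Prop :=
  i < j ∧ j ≤ i + 3 ∨ j < i ∧ i ≤ j + 3

/-- The third power of the path on `n` vertices. -/
def pathCube (n : ℕ) : SimpleGraph (Fin n) where
  Adj i j := PathCubeAdj i j
  symm := ⟨fun _ _ h => h.symm⟩
  loopless := ⟨fun _ h => by
    simp only [PathCubeAdj] at h
    omega⟩

/-- The rotation at `i` in the plane embedding of `pathCube n`: the cyclic order of the neighbours
is `i + 1, i + 3, i + 2, i - 1, i - 3, i - 2`. -/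
def pathCubeNext (n i j : ℕ) : ℕ :=
  if j = i + 1 then if i + 3 < n then i + 3 else if i + 2 < n then i + 2 else i - 1
  else if j = i + 3 then i + 2
  else if j = i + 2 then if 1 ≤ i then i - 1 else i + 1
  else if j + 1 = i then if 3 ≤ i then i - 3 else if 2 ≤ i then i - 2 else i + 1
  else if j + 3 = i then i - 2
  else if i + 1 < n then i + 1 else i - 1

theorem pathCube_connected {n : ℕ} (hn : 3 ≤ n) : (pathCube n).Connected :=
  connected_of_forall_exists_lt (A := PathCubeAdj) (fun _ _ => Iff.rfl) (by omega) fun j _ hj =>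
    ⟨j - 1, by omega, Or.inl (by omega)⟩

theorem card_edgeSet_pathCube {n : ℕ} (hn : 3 ≤ n) :
    Nat.card (pathCube n).edgeSet + 6 = 3 * n := by
  rw [card_edgeSet_eq_sum (A := PathCubeAdj) (fun _ _ => Iff.rfl)]
  have h : ∀ j, 3 ≤ j → ((Finset.range j).filter fun i => PathCubeAdj i j) =
      {j - 1, j - 2, j - 3} := by
    intro j hj
    ext i
    simp only [Finset.mem_filter, Finset.mem_range, Finset.mem_insert, Finset.mem_singleton, PathCubeAdj]
    omega
  induction n, hn using Nat.le_induction with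
  | base => decide
  | succ j hj ih =>
    rw [Finset.sum_range_succ, h j hj, Finset.card_eq_three.2 ⟨_, _, _, _, _, _, rfl⟩] <;> omega

/-- The labels wind around a cylinder of circumference three with triangles `{i, i+1, i+3}` and `{i,
i+2, i+3}`; the first three and the last three labels form the end faces. -/
theorem pathCube_isSimpleTriangulation {n : ℕ} (hn : 3 ≤ n) :
    (pathCube n).IsSimpleTriangulation := by
  refine isSimpleTriangulation_of_next (A := PathCubeAdj) (fun _ _ => Iff.rfl) (pathCube_connected hn)
    -- Each rotation is cut after `i - 1`, or after 2 at vertex 0; the rank counts positions back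
    -- from there.
    (pathCubeNext n) ?_ (fun i => if 1 ≤ i then i - 1 else i + 2)
    (fun i j => if j + 1 = i then 0 else if j = i + 2 then 1 else if j = i + 3 then 2
      else if j = i + 1 then 3 else if j + 2 = i then 4 else 5) ?_ ?_ (card_edgeSet_pathCube hn)
  · intro i hi j hj h
    simp only [PathCubeAdj] at h
    simp only [pathCubeNext, PathCubeAdj]
    split_ifs <;> omega
  · intro i hi j hj h
    simp only [PathCubeAdj] at h
    obtain rfl | rfl | rfl | rfl | rfl | rfl : j = i + 1 ∨ j = i + 2 ∨ j = i + 3 ∨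
        i = j + 1 ∨ i = j + 2 ∨ i = j + 3 := by omega
    all_goals
      simp only [pathCubeNext]
      grind
  · intro i hi j hj h
    simp only [PathCubeAdj] at h
    obtain rfl | rfl | rfl | rfl | rfl | rfl : j = i + 1 ∨ j = i + 2 ∨ j = i + 3 ∨
        i = j + 1 ∨ i = j + 2 ∨ i = j + 3 := by omega
    all_goals
      simp only [pathCubeNext]
      grind

theorem remoteness_pathCube {n : ℕ} (hn : 3 ≤ n) :
    remotenessBound 3 n ≤ (pathCube n).remoteness :=
  le_remoteness_of_ceil _ (pathCube_connected hn) (by norm_num) fun i j h => by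
    simp only [pathCube, PathCubeAdj] at h
    omega

/-! ### Extremal quadrangulations -/

/-- Adjacency of numbers in consecutive layers, the layers being `{0}, {1, 2}, {3, 4}, …`. -/
abbrev PairLayersAdj (i j : ℕ) : Prop :=
  (j + 1) / 2 = (i + 1) / 2 + 1 ∨ (i + 1) / 2 = (j + 1) / 2 + 1

/-- The graph on `0, …, n - 1` in which consecutive layers of `{0}, {1, 2}, {3, 4}, …` are
completely joined. -/
def pairLayers (n : ℕ) : SimpleGraph (Fin n) where
  Adj i j := PairLayersAdj i j
  symm := ⟨fun _ _ h => h.symm⟩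
  loopless := ⟨fun _ h => by
    simp only [PairLayersAdj] at h
    omega⟩

/-- The rotation at `i` in the plane embedding of `pairLayers n`: the cyclic order of the neighbours
is `i - 2, i + 3, i + 2, i - 1` for odd `i` and `i - 3, i - 2, i + 1, i + 2` for even `i`. -/
def pairLayersNext (n i j : ℕ) : ℕ :=
  if i % 2 = 1 then
    if j + 2 = i then if i + 3 < n then i + 3 else if i + 2 < n then i + 2 else i - 1
    else if j = i + 3 then i + 2
    else if j = i + 2 then i - 1
    else if 3 ≤ i then i - 2 else if i + 3 < n then i + 3 else i + 2
  else
    if j + 3 = i then i - 2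
    else if j + 2 = i then if i + 1 < n then i + 1 else i - 3
    else if j = i + 1 then
      if i + 2 < n then i + 2 else if 4 ≤ i then i - 3 else i - 2
    else if 4 ≤ i then i - 3 else if 2 ≤ i then i - 2 else i + 1

/-- Writing both labels in terms of `x` removes the divisions by 2, so parity tests in the rotation
can be simplified away. -/
theorem PairLayersAdj.cases {i j : ℕ} (h : PairLayersAdj i j) :
    ∃ x, (i = 2 * x ∧ j = 2 * x + 1 ∨ i = 2 * x ∧ j = 2 * x + 2 ∨
        i = 2 * x + 1 ∧ j = 2 * x + 3 ∨ i = 2 * x + 1 ∧ j = 2 * x + 4) ∨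
      (j = 2 * x ∧ i = 2 * x + 1 ∨ j = 2 * x ∧ i = 2 * x + 2 ∨
        j = 2 * x + 1 ∧ i = 2 * x + 3 ∨ j = 2 * x + 1 ∧ i = 2 * x + 4) := by
  have key : ∀ i j, (j + 1) / 2 = (i + 1) / 2 + 1 →
      ∃ x, i = 2 * x ∧ j = 2 * x + 1 ∨ i = 2 * x ∧ j = 2 * x + 2 ∨
        i = 2 * x + 1 ∧ j = 2 * x + 3 ∨ i = 2 * x + 1 ∧ j = 2 * x + 4 := by
    intro i j h
    obtain ⟨x, rfl | rfl⟩ : ∃ x, i = 2 * x ∨ i = 2 * x + 1 := ⟨i / 2, by omega⟩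
    all_goals exact ⟨x, by omega⟩
  rcases h with h | h
  · obtain ⟨x, hx⟩ := key i j h
    exact ⟨x, Or.inl hx⟩
  · obtain ⟨x, hx⟩ := key j i h
    exact ⟨x, Or.inr hx⟩

theorem pairLayersNext_spec {n i j : ℕ} (hn : 4 ≤ n) (hi : i < n) (hj : j < n)
    (h : PairLayersAdj i j) :
    pairLayersNext n i j < n ∧ PairLayersAdj i (pairLayersNext n i j) := by
  generalize hk : pairLayersNext n i j = k
  simp only [PairLayersAdj]
  obtain ⟨x, (⟨rfl, rfl⟩ | ⟨rfl, rfl⟩ | ⟨rfl, rfl⟩ | ⟨rfl, rfl⟩) | ⟨rfl, rfl⟩ | ⟨rfl, rfl⟩ |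
    ⟨rfl, rfl⟩ | ⟨rfl, rfl⟩⟩ := h.cases
  all_goals
    clear h
    rcases x with _ | _ | x <;> simp [pairLayersNext, mul_add, add_assoc] at hk <;>
    (try split_ifs at hk) <;> subst hk <;> omega

theorem pairLayersNext_ne {n i j : ℕ} (hn : 4 ≤ n) (hi : i < n) (hj : j < n)
    (h : PairLayersAdj i j) : pairLayersNext n i j ≠ j := by
  obtain ⟨x, (⟨rfl, rfl⟩ | ⟨rfl, rfl⟩ | ⟨rfl, rfl⟩ | ⟨rfl, rfl⟩) | ⟨rfl, rfl⟩ | ⟨rfl, rfl⟩ |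
    ⟨rfl, rfl⟩ | ⟨rfl, rfl⟩⟩ := h.cases
  all_goals
    clear h
    rcases x with _ | _ | x <;> simp [pairLayersNext, mul_add, add_assoc] <;>
    (try split_ifs) <;> first | exact not_false | omega

/-- Away from the ends, a face consists of both vertices of one layer and one vertex of each
neighbouring layer. -/
theorem pairLayersNext_face {n i j k l : ℕ} (hn : 4 ≤ n) (hi : i < n) (hj : j < n)
    (h : PairLayersAdj i j) (hk : pairLayersNext n j i = k) (hl : pairLayersNext n k j = l) :
    pairLayersNext n l k = i := by
  obtain ⟨x, (⟨rfl, rfl⟩ | ⟨rfl, rfl⟩ | ⟨rfl, rfl⟩ | ⟨rfl, rfl⟩) | ⟨rfl, rfl⟩ | ⟨rfl, rfl⟩ |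
    ⟨rfl, rfl⟩ | ⟨rfl, rfl⟩⟩ := h.cases
  all_goals
    clear h
    rcases x with _ | _ | x <;> simp [pairLayersNext, mul_add, add_assoc] at hk <;>
    (try split_ifs at hk) <;> subst hk <;>
    simp [pairLayersNext, mul_add, add_assoc] at hl <;> (try split_ifs at hl) <;> subst hl <;>
    simp [pairLayersNext, mul_add, add_assoc] <;> (try split_ifs) <;> omega

/-- The position of `j`, counted from the end, in the rotation at `i`. -/
def pairLayersRank (i j : ℕ) : ℕ :=
  if i % 2 = 1 then if j + 1 = i then 0 else if j = i + 2 then 1 else if j = i + 3 then 2 else 3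
  else if j + 2 = i then 0 else if j + 3 = i then 1 else if j = i + 2 then 2 else 3

theorem pairLayersRank_lt {n i j : ℕ} (hn : 4 ≤ n) (hi : i < n) (hj : j < n)
    (h : PairLayersAdj i j) :
    (j = if i % 2 = 1 then i - 1 else if 2 ≤ i then i - 2 else i + 2) ∨
      pairLayersRank i (pairLayersNext n i j) < pairLayersRank i j := by
  generalize hk : pairLayersNext n i j = k
  obtain ⟨x, (⟨rfl, rfl⟩ | ⟨rfl, rfl⟩ | ⟨rfl, rfl⟩ | ⟨rfl, rfl⟩) | ⟨rfl, rfl⟩ | ⟨rfl, rfl⟩ |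
    ⟨rfl, rfl⟩ | ⟨rfl, rfl⟩⟩ := h.cases
  all_goals
    clear h
    rcases x with _ | _ | x <;> simp [pairLayersNext, mul_add, add_assoc] at hk <;>
    (try split_ifs at hk) <;> subst hk <;>
    simp [pairLayersRank, mul_add, add_assoc] <;> omega

theorem pairLayers_connected {n : ℕ} (hn : 3 ≤ n) : (pairLayers n).Connected :=
  connected_of_forall_exists_lt (A := PairLayersAdj) (fun _ _ => Iff.rfl) (by omega) fun j _ hj =>
    ⟨if j % 2 = 1 then j - 1 else j - 2, by split_ifs <;> omega, Or.inl (by split_ifs <;> omega)⟩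

theorem card_edgeSet_pairLayers {n : ℕ} (hn : 3 ≤ n) :
    Nat.card (pairLayers n).edgeSet + 4 = 2 * n := by
  rw [card_edgeSet_eq_sum (A := PairLayersAdj) (fun _ _ => Iff.rfl)]
  have h : ∀ j, 3 ≤ j → ((Finset.range j).filter fun i => PairLayersAdj i j) =
      {2 * ((j + 1) / 2) - 3, 2 * ((j + 1) / 2) - 2} := by
    intro j hj
    ext i
    simp only [Finset.mem_filter, Finset.mem_range, Finset.mem_insert, Finset.mem_singleton,
      PairLayersAdj]
    omega
  induction n, hn using Nat.le_induction with
  | base => decide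
  | succ j hj ih =>
    rw [Finset.sum_range_succ, h j hj, Finset.card_pair] <;> omega

theorem pairLayers_isSimpleQuadrangulation {n : ℕ} (hn : 4 ≤ n) :
    (pairLayers n).IsSimpleQuadrangulation :=
  isSimpleQuadrangulation_of_next (A := PairLayersAdj) (fun _ _ => Iff.rfl)
    (pairLayers_connected (by omega)) (pairLayersNext n)
    (fun _ hi _ hj h => pairLayersNext_spec hn hi hj h) _ pairLayersRank
    (fun _ hi _ hj h => pairLayersRank_lt hn hi hj h)
    (fun _ hi _ hj h => pairLayersNext_ne hn hj hi h.symm)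
    (fun _ hi _ hj h => pairLayersNext_face hn hi hj h rfl rfl)
    (card_edgeSet_pairLayers (by omega))

theorem remoteness_pairLayers {n : ℕ} (hn : 4 ≤ n) :
    remotenessBound 2 n ≤ (pairLayers n).remoteness :=
  le_remoteness_of_ceil _ (pairLayers_connected (by omega)) (by norm_num) fun i j h => by
    simp only [pairLayers, PairLayersAdj] at h
    omega

/-! ### Extremal 4-connected triangulations -/

/-- Adjacency in a helical triangulation of a cylinder of circumference four, whose ends are closed
by the chords `{0, 2}` and `{n - 3, n - 1}`. -/
abbrev HelixAdj (n i j : ℕ) : Prop :=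
  (j = i + 1 ∨ j = i + 3 ∨ j = i + 4 ∨ j = i + 2 ∧ (i = 0 ∨ i + 3 = n)) ∨
  (i = j + 1 ∨ i = j + 3 ∨ i = j + 4 ∨ i = j + 2 ∧ (j = 0 ∨ j + 3 = n))

/-- The helical triangulation of the sphere with `n` vertices and distance layers of size four. -/
def helix (n : ℕ) : SimpleGraph (Fin n) where
  Adj i j := HelixAdj n i j
  symm := ⟨fun _ _ h => h.symm⟩
  loopless := ⟨fun _ h => by
    simp only [HelixAdj] at h
    omega⟩

/-- The rotation at `i` in the plane embedding of `helix n`: the cyclic order of the neighbours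
is `i + 1, i + 4, i + 3, i + 2, i - 1, i - 4, i - 3, i - 2`. -/
def helixNext (n i j : ℕ) : ℕ :=
  if j = i + 1 then
    if i + 4 < n then i + 4 else if i + 3 < n then i + 3 else if i + 2 < n then i + 2 else i - 1
  else if j = i + 4 then i + 3
  else if j = i + 3 then if i = 0 then i + 2 else i - 1
  else if j = i + 2 then if 1 ≤ i then i - 1 else i + 1
  else if j + 1 = i then
    if 4 ≤ i then i - 4 else if 3 ≤ i then i - 3 else if 2 ≤ i then i - 2 else i + 1
  else if j + 4 = i then i - 3
  else if j + 3 = i then if i + 1 = n then i - 2 else i + 1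
  else if i + 1 < n then i + 1 else i - 1

theorem helix_connected {n : ℕ} (hn : 6 ≤ n) : (helix n).Connected :=
  connected_of_forall_exists_lt (A := HelixAdj n) (fun _ _ => Iff.rfl) (by omega) fun j _ hj =>
    ⟨j - 1, by omega, Or.inl (by omega)⟩

theorem card_edgeSet_helix {n : ℕ} (hn : 6 ≤ n) : Nat.card (helix n).edgeSet + 6 = 3 * n := by
  rw [card_edgeSet_eq_sum (A := HelixAdj n) (fun _ _ => Iff.rfl)]
  obtain ⟨m, rfl⟩ : ∃ m, n = m + 1 := ⟨n - 1, by omega⟩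
  -- Only the last vertex has four smaller neighbours: `m - 2` is joined to it by the closing chord.
  have hlast : ((Finset.range m).filter fun i => HelixAdj (m + 1) i m) =
      {m - 1, m - 2, m - 3, m - 4} := by
    ext i
    simp only [Finset.mem_filter, Finset.mem_range, Finset.mem_insert, Finset.mem_singleton,
      HelixAdj]
    omega
  have h : ∀ j, 4 ≤ j → j < m → ((Finset.range j).filter fun i => HelixAdj (m + 1) i j) =
      {j - 1, j - 3, j - 4} := by
    intro j hj hjm
    ext i
    simp only [Finset.mem_filter, Finset.mem_range, Finset.mem_insert, Finset.mem_singleton,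
      HelixAdj]
    omega
  have hsmall : ∀ j < 4, ((Finset.range j).filter fun i => HelixAdj (m + 1) i j) =
      (Finset.range j).filter fun i => i + 1 = j ∨ i = 0 := by
    intro j hj
    refine Finset.filter_congr fun i hi => ?_
    rw [Finset.mem_range] at hi
    simp only [HelixAdj]
    omega
  have hsum : ∀ k, 4 ≤ k → k ≤ m → ∑ j ∈ Finset.range k,
      ((Finset.range j).filter fun i => HelixAdj (m + 1) i j).card + 7 = 3 * k := by
    intro k hk
    induction k, hk using Nat.le_induction with
    | base =>
      intro _
      rw [Finset.sum_congr rfl fun j hj => by rw [hsmall j (Finset.mem_range.1 hj)]]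
      decide
    | succ k hk ih =>
      intro hkm
      have := ih (by omega)
      rw [Finset.sum_range_succ, h k hk (by omega),
        Finset.card_eq_three.2 ⟨_, _, _, _, _, _, rfl⟩] <;> omega
  have := hsum m (by omega) le_rfl
  rw [Finset.sum_range_succ, hlast]
  have h4 : ({m - 1, m - 2, m - 3, m - 4} : Finset ℕ).card = 4 := by
    rw [Finset.card_insert_of_notMem, Finset.card_eq_three.2 ⟨_, _, _, _, _, _, rfl⟩]
    all_goals simp
    all_goals omega
  omega

/-- The triangles are `{i, i+1, i+4}` and `{i, i+3, i+4}`; each chord splits the 4-cycle at its end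
into two further triangles. -/
theorem helix_isSimpleTriangulation {n : ℕ} (hn : 6 ≤ n) : (helix n).IsSimpleTriangulation := by
  refine isSimpleTriangulation_of_next (A := HelixAdj n) (fun _ _ => Iff.rfl) (helix_connected hn)
    (helixNext n) ?_ (fun i => if 1 ≤ i then i - 1 else i + 2)
    (fun i j => if j + 1 = i then 0 else if j = i + 2 then 1 else if j = i + 3 then 2
      else if j = i + 4 then 3 else if j = i + 1 then 4 else if j + 2 = i then 5
      else if j + 3 = i then 6 else 7) ?_ ?_ (card_edgeSet_helix hn)
  · intro i hi j hj h
    obtain (rfl | rfl | rfl | ⟨rfl, h⟩) | (rfl | rfl | rfl | ⟨rfl, h⟩) := h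
    all_goals
      simp only [helixNext, HelixAdj]
      grind
  · intro i hi j hj h
    obtain (rfl | rfl | rfl | ⟨rfl, h⟩) | (rfl | rfl | rfl | ⟨rfl, h⟩) := h
    all_goals
      simp only [helixNext]
      grind
  · intro i hi j hj h
    obtain (rfl | rfl | rfl | ⟨rfl, h⟩) | (rfl | rfl | rfl | ⟨rfl, h⟩) := h
    all_goals
      simp only [helixNext]
      grind

theorem remoteness_helix {n : ℕ} (hn : 6 ≤ n) : remotenessBound 4 n ≤ (helix n).remoteness :=
  le_remoteness_of_ceil _ (helix_connected hn) (by norm_num) fun i j h => by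
    simp only [helix, HelixAdj] at h
    omega

/-- Every surviving vertex except the least is linked among survivors to a smaller one; descent then
reaches the least. -/
theorem helix_isVertexConnected {n : ℕ} (hn : 6 ≤ n) : (helix n).IsVertexConnected 4 := by
  refine ⟨by rw [Nat.card_eq_fintype_card, Fintype.card_fin]; omega, fun S hS => ?_⟩
  let T : Finset ℕ := S.map Fin.valEmbedding
  have hT : T.card < 4 := by rwa [Finset.card_map]
  have hmem : ∀ i (hi : i < n), (⟨i, hi⟩ : Fin n) ∈ ((S : Set (Fin n))ᶜ) ↔ i ∉ T := by
    intro i hi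
    rw [Set.mem_compl_iff, Finset.mem_coe, not_iff_not, Finset.mem_map]
    exact ⟨fun h => ⟨_, h, rfl⟩, fun ⟨x, hx, hxi⟩ => by rwa [← Fin.ext (b := ⟨i, hi⟩) hxi]⟩
  have hcard : ∀ a b c d : ℕ, a ∈ T → b ∈ T → c ∈ T → d ∈ T → a < b → b < c → c < d → False := by
    intro a b c d ha hb hc hd hab hbc hcd
    have h4 : ({a, b, c, d} : Finset ℕ).card = 4 := by
      rw [Finset.card_insert_of_notMem, Finset.card_eq_three.2 ⟨_, _, _, _, _, _, rfl⟩]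
      all_goals simp
      all_goals omega
    have := Finset.card_le_card (show ({a, b, c, d} : Finset ℕ) ⊆ T by
      simp [Finset.insert_subset_iff, *])
    omega
  let H := (helix n).induce ((S : Set (Fin n))ᶜ)
  let R : ℕ → ℕ → Prop := fun i j => ∃ (hi : i < n) (hj : j < n) (hi' : i ∉ T) (hj' : j ∉ T),
    H.Reachable ⟨⟨i, hi⟩, (hmem i hi).2 hi'⟩ ⟨⟨j, hj⟩, (hmem j hj).2 hj'⟩
  have hadj : ∀ i j, i < n → j < n → i ∉ T → j ∉ T → HelixAdj n i j → R i j :=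
    fun i j hi hj hi' hj' h => ⟨hi, hj, hi', hj', Adj.reachable (by exact h)⟩
  have htrans : ∀ i j k, R i j → R j k → R i k := fun i j k ⟨hi, _, hi', _, h1⟩ ⟨_, hk, _, hk', h2⟩ =>
    ⟨hi, hk, hi', hk', h1.trans h2⟩
  have hdown : ∀ j < n, j ∉ T → (∀ i < j, i ∈ T) ∨ ∃ i < j, R i j := by
    intro j hj hj'
    by_contra! hcon
    obtain ⟨⟨i, hij, hi⟩, hR⟩ := hcon
    have hT : ∀ i < j, HelixAdj n i j → i ∈ T := fun i hij h => by
      by_contra hi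
      exact hR i hij (hadj i j (hij.trans hj) hj hi hj' h)
    have h1 : j - 1 ∈ T := hT _ (by omega) (Or.inl (by omega))
    have h3 : 3 ≤ j → j - 3 ∈ T := fun h => hT _ (by omega) (Or.inl (by omega))
    have h4 : 4 ≤ j → j - 4 ∈ T := fun h => hT _ (by omega) (Or.inl (by omega))
    have h2j : 2 ≤ j := by
      by_contra! h
      obtain ⟨rfl, rfl⟩ : j = 1 ∧ i = 0 := by omega
      exact hi h1
    -- The smaller neighbours of `j` are all deleted. Were `j - 2` deleted too, four deletions would
    -- result, or for `j < 4` no smaller survivor.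
    have hj2 : j - 2 ∉ T := by
      intro h2
      rcases Nat.lt_or_ge j 4 with h | h
      · obtain h | h | h : i = j - 1 ∨ i = j - 2 ∨ 3 ≤ j ∧ i = j - 3 := by omega
        · exact hi (h ▸ h1)
        · exact hi (h ▸ h2)
        · exact hi (h.2 ▸ h3 h.1)
      · exact hcard (j - 4) (j - 3) (j - 2) (j - 1) (h4 h) (h3 (by omega)) h2 h1
          (by omega) (by omega) (by omega)
    -- Otherwise `j` is 2 or `n - 1`, and a closing chord joins it to `j - 2`.
    have hjn : 3 ≤ j ∧ j + 1 < n := by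
      by_contra h
      exact hj2 (hT _ (by omega) (Or.inl (by omega)))
    have hpath : ∀ k < n, k ∉ T → HelixAdj n (j - 2) k → HelixAdj n k j → False :=
      fun k hk hk' ha hb => hR (j - 2) (by omega) (htrans _ _ _
        (hadj _ _ (by omega) hk hj2 hk' ha) (hadj _ _ hk hj hk' hj' hb))
    have hup : j + 1 ∈ T := by
      by_contra h
      exact hpath (j + 1) hjn.2 h (Or.inl (by omega)) (Or.inr (by omega))
    rcases Nat.lt_or_ge 3 j with h | h
    · exact hcard (j - 4) (j - 3) (j - 1) (j + 1) (h4 h) (h3 hjn.1) h1 hup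
        (by omega) (by omega) (by omega)
    -- Here 0, 2 and 4 are the only deletions. The detour from 1 to 3 is `1, 5, 6, 3`, or `1, 5, 3`
    -- along the chord when `n = 6`.
    · obtain rfl : j = 3 := by omega
      have h0 : 0 ∈ T := h3 le_rfl
      have h5 : 5 ∉ T := fun h5 => hcard 0 2 4 5 h0 h1 hup h5
        (by norm_num) (by norm_num) (by norm_num)
      rcases hn.eq_or_lt with rfl | hn
      · exact hpath 5 (by omega) h5 (by decide) (by decide)
      · have h6 : 6 ∉ T := fun h6 => hcard 0 2 4 6 h0 h1 hup h6
          (by norm_num) (by norm_num) (by norm_num)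
        exact hR 1 (by omega) (htrans _ 6 _ (htrans _ 5 _
          (hadj _ _ (by omega) (by omega) hj2 h5 (Or.inl (by omega)))
          (hadj _ _ (by omega) (by omega) h5 h6 (Or.inl (by omega))))
          (hadj _ _ (by omega) hj h6 hj' (Or.inr (by omega))))
  have hmin : ∃ m, m < n ∧ m ∉ T := by
    by_contra! h
    exact hcard 0 1 2 3 (h 0 (by omega)) (h 1 (by omega)) (h 2 (by omega)) (h 3 (by omega))
      (by norm_num) (by norm_num) (by norm_num)
  classical
  obtain ⟨hm, hm'⟩ := Nat.find_spec hmin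
  have hlow : ∀ i < Nat.find hmin, i ∈ T := fun i hi => by
    by_contra h
    exact Nat.find_min hmin hi ⟨hi.trans hm, h⟩
  generalize Nat.find hmin = m at hm hm' hlow
  have hreach : ∀ j < n, j ∉ T → R m j := by
    intro j
    induction j using Nat.strong_induction_on with
    | _ j ih =>
      intro hj hj'
      have hmj : m ≤ j := by
        by_contra! h
        exact hj' (hlow j h)
      rcases hmj.eq_or_lt with rfl | hmj
      · exact ⟨hj, hj, hj', hj', Reachable.refl _⟩
      · rcases hdown j hj hj' with h | ⟨i, hij, h⟩
        · exact absurd (h m hmj) hm'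
        · exact htrans _ _ _ (ih i hij h.1 h.2.2.1) h
  have hroot : ∀ x : ((S : Set (Fin n))ᶜ : Set (Fin n)),
      H.Reachable ⟨⟨m, hm⟩, (hmem m hm).2 hm'⟩ x := fun x =>
    (hreach x.1 x.1.2 ((hmem _ _).1 x.2)).2.2.2.2
  have : Nonempty ((S : Set (Fin n))ᶜ : Set (Fin n)) := ⟨⟨⟨m, hm⟩, (hmem m hm).2 hm'⟩⟩
  exact ⟨fun x y => (hroot x).symm.trans (hroot y)⟩

/-! ### The three upper bounds -/

variable {V : Type*} [Fintype V] {G : SimpleGraph V}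

theorem IsSimpleTriangulation.remoteness_le (hG : G.IsSimpleTriangulation) :
    G.remoteness ≤ ((Fintype.card V : ℝ) + 2) / 6 + epsTriangulation (Fintype.card V) := by
  obtain ⟨M, hM⟩ := hG
  rw [← remotenessBound_three M.one_lt_card]
  exact hM.noSeparator_three.remoteness_le M.connected (by norm_num)

theorem IsSimpleQuadrangulation.remoteness_le (hG : G.IsSimpleQuadrangulation) :
    G.remoteness ≤ ((Fintype.card V : ℝ) + 1) / 4 + epsQuadrangulation (Fintype.card V) := by
  obtain ⟨M, hM⟩ := hG
  rw [← remotenessBound_two M.one_lt_card]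
  exact hM.noSeparator_two.remoteness_le M.connected (by norm_num)

theorem IsVertexConnected.connected {k : ℕ} (hk : 0 < k) (hG : G.IsVertexConnected k) :
    G.Connected := by
  have : Nonempty V := Fintype.card_pos_iff.1 (Nat.card_eq_fintype_card (α := V) ▸ by
    have := hG.1
    omega)
  refine ⟨fun u v => ?_⟩
  have h := hG.noSeparator ∅ (by simpa using hk) (fun x => G.Reachable u x)
    (fun x y _ _ hxy => ⟨fun h => h.trans hxy.reachable, fun h => h.trans hxy.symm.reachable⟩)
    u v (by simp) (by simp)
  exact h.1 (Reachable.refl u)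

theorem IsVertexConnected.remoteness_le (hG : G.IsVertexConnected 4) :
    G.remoteness ≤ ((Fintype.card V : ℝ) + 3) / 8 + epsFourConnected (Fintype.card V) := by
  have h := hG.1
  rw [Nat.card_eq_fintype_card] at h
  rw [← remotenessBound_four (by omega)]
  exact hG.noSeparator.remoteness_le (hG.connected (by norm_num)) (by norm_num)

end SimpleGraph

theorem mainTheorem4 :
    -- (a) simple triangulations: the bound, and its sharpness
    ((∀ {V : Type*} [Fintype V] (G : SimpleGraph V), G.IsSimpleTriangulation →
        G.remoteness ≤ ((Fintype.card V : ℝ) + 2) / 6 + epsTriangulation (Fintype.card V)) ∧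
      (∀ n : ℕ, 3 ≤ n → ∃ G : SimpleGraph (Fin n), G.IsSimpleTriangulation ∧
        G.remoteness = ((n : ℝ) + 2) / 6 + epsTriangulation n)) ∧
    -- (b) 4-connected simple triangulations: the bound, and its sharpness
    ((∀ {V : Type*} [Fintype V] (G : SimpleGraph V), G.IsSimpleTriangulation →
        G.IsVertexConnected 4 →
        G.remoteness ≤ ((Fintype.card V : ℝ) + 3) / 8 + epsFourConnected (Fintype.card V)) ∧
      (∀ n : ℕ, 6 ≤ n → ∃ G : SimpleGraph (Fin n), G.IsSimpleTriangulation ∧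
        G.IsVertexConnected 4 ∧
        G.remoteness = ((n : ℝ) + 3) / 8 + epsFourConnected n)) ∧
    -- (c) simple quadrangulations: the bound, and its sharpness
    ((∀ {V : Type*} [Fintype V] (G : SimpleGraph V), G.IsSimpleQuadrangulation →
        G.remoteness ≤ ((Fintype.card V : ℝ) + 1) / 4 + epsQuadrangulation (Fintype.card V)) ∧
      (∀ n : ℕ, 4 ≤ n → ∃ G : SimpleGraph (Fin n), G.IsSimpleQuadrangulation ∧
        G.remoteness = ((n : ℝ) + 1) / 4 + epsQuadrangulation n)) := by

  refine ⟨⟨fun G hG => ?_, fun n hn => ?_⟩, ⟨fun G hG h4 => ?_, fun n hn => ?_⟩,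
    ⟨fun G hG => ?_, fun n hn => ?_⟩⟩
  · exact hG.remoteness_le
  · have h := SimpleGraph.pathCube_isSimpleTriangulation hn
    refine ⟨_, h, le_antisymm ?_ ?_⟩
    · simpa using h.remoteness_le
    · rw [← SimpleGraph.remotenessBound_three (by omega)]
      exact SimpleGraph.remoteness_pathCube hn
  · exact h4.remoteness_le
  · have h := SimpleGraph.helix_isVertexConnected hn
    refine ⟨_, SimpleGraph.helix_isSimpleTriangulation hn, h, le_antisymm ?_ ?_⟩
    · simpa using h.remoteness_le
    · rw [← SimpleGraph.remotenessBound_four (by omega)]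
      exact SimpleGraph.remoteness_helix hn
  · exact hG.remoteness_le
  · have h := SimpleGraph.pairLayers_isSimpleQuadrangulation hn
    refine ⟨_, h, le_antisymm ?_ ?_⟩
    · simpa using h.remoteness_le
    · rw [← SimpleGraph.remotenessBound_two (by omega)]
      exact SimpleGraph.remoteness_pairLayers hn
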